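/- **Model.** Fix $T>0$, a ceiling $\bar y>0$, constants $b^I,b^R,\sigma^R,\gamma^R,\theta^I,\theta^R>0$ and $a^R,\rho^I,\rho^R\in\mathbb R$, and a standard Brownian motion $B^R$ on a probability space. For a nondecreasing càdlàg coverage path $\xi$ on $[t,T]$ with $\xi_{t-}=y$, the reinsurer's exposure $Z^\xi$ solves $dZ_r=(a^R-b^RZ_r)\,dr+\sigma^R\,dB^R_r+d\xi_r$, $Z_{t-}=z$, and for a rate $c$ his cost is $$\mathcal J(t,y,z;\xi,c)=\mathbb E Z^\xi_T+\gamma^R\,\mathrm{Var}\,Z^\xi_T-\theta^R\,\mathbb E\int_{[t,T]}e^{\rho^R(T-r)}c(r)\,d\xi_r ,$$ where the integral includes a jump of $\xi$ at $t$. **Insurer's response.** Let $\kappa(t)=\frac1{\theta^I}e^{-(b^I+\rho^I)(T-t)}$. A premium strategy is a function $c:[0,T]\to[0,\infty)$ such that for every $t\in[0,T]$ the set $\{\tau\in[t,T]: c(\tau)\le\kappa(\tau)\}$ is empty or has a least element; $p(t;c)$ denotes this least element, and $p(t;c)=\infty$ if the set is empty. Let $\mathcal C$ be the set of premium strategies.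 Given $c\in\mathcal C$ and initial data $(x,t,y)\in\mathbb R\times[0,T]\times[0,\bar y]$, the insurer follows the equilibrium reinsurance strategy of buying the whole remaining coverage $\bar y-y$ at the time $p(t;c)$ (nothing if $p(t;c)=\infty$), that is, $\xi_r=y+(\bar y-y)1_{r\ge p(t;c)}$. With this $\xi$ put $J^R(x,t,y,z;c)=\mathcal J(t,y,z;\xi,c)$. **Equilibrium premium strategy.** $\hat c\in\mathcal C$ is an equilibrium premium strategy if for all $x,z\in\mathbb R$, $y\in[0,\bar y]$ and $\tilde c\in\mathcal C$: (a) for every $t\in[0,T)$, $\liminf_{h\downarrow0}\frac{J^R(x,t,y,z;c^h)-J^R(x,t,y,z;\hat c)}{h}\ge0$, where $c^h=\tilde c$ on $[t,t+h)$ and $c^h=\hat c$ elsewhere; (b) $J^R(x,T,y,z;\tilde c)-J^R(x,T,y,z;\hat c)\ge0$. **Equilibrium selected time.** For $p\in[t,T]\cup\{\infty\}$ let $K(t,y,z,p)=\mathcal J(t,y,z;\xi,\kappa)$ with $\xi_r=y+(\bar y-y)1_{r\ge p}$: the remaining coverage is transferred at time $p$ at the rate $\kappa(p)$, and not at all if $p=\infty$.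 The purchasing time $p(\cdot\,;c)$ is an equilibrium selected time of the time-selection problem if for all $(t,y,z)\in[0,T]\times[0,\bar y]\times\mathbb R$: (a) $K(t,y,z,t)\ge K(t,y,z,p(t;c))$; (b) $\lim_{h\downarrow0}\frac{K(t,y,z,p^h(t;c))-K(t,y,z,p(t;c))}{h}$ exists in $[-\infty,\infty]$ and is $\ge0$, where $p^h(t;c)$ is the purchasing time when the times in $[t,t+h)$ cannot be selected: the least $\tau\in[t,T]\setminus[t,t+h)$ with $c(\tau)\le\kappa(\tau)$, and $\infty$ if there is none. **Corollary (equivalence of equilibria).** Let $\hat c\in\mathcal C$. Then $\hat c$ is an equilibrium premium strategy if and only if $\hat c(t)=\kappa(t)$ for every $t\in[0,T]$ with $\hat c(t)\le\kappa(t)$ and $p(\cdot\,;\hat c)$ is an equilibrium selected time. In particular, for premium strategies that charge exactly $\kappa$ on the purchasing region $\{c\le\kappa\}$, the two equilibrium notions are equivalent. -/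

import Mathlib

open MeasureTheory ProbabilityTheory Filter Topology Set
open scoped NNReal ENNReal

noncomputable section

namespace Reinsurance

/-- The constants that enter the reinsurer's problem. Superscripts `I` and `R` of the model
(insurer, reinsurer) are written as suffixes; `ybar` is the ceiling on the reinsurance coverage. -/
structure Model where
  /-- time horizon -/
  T : ℝ
  /-- maximal coverage -/
  ybar : ℝ
  /-- drift constant of the reinsurer's exposure -/
  aR : ℝ
  /-- reversion coefficient of the reinsurer -/
  bR : ℝ
  /-- reversion coefficient of the insurer -/
  bI : ℝ
  /-- volatility of the reinsurer's exposure -/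
  sigmaR : ℝ
  /-- weight of the variance in the reinsurer's objective -/
  gammaR : ℝ
  /-- weight of the premium in the insurer's objective -/
  thetaI : ℝ
  /-- weight of the premium in the reinsurer's objective -/
  thetaR : ℝ
  /-- discount factor of the insurer -/
  rhoI : ℝ
  /-- discount factor of the reinsurer -/
  rhoR : ℝ
  T_pos : 0 < T
  ybar_pos : 0 < ybar
  bR_pos : 0 < bR
  bI_pos : 0 < bI
  sigmaR_pos : 0 < sigmaR
  gammaR_pos : 0 < gammaR
  thetaI_pos : 0 < thetaI
  thetaR_pos : 0 < thetaR

namespace Model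

variable (M : Model)

/-- The insurer's threshold `κ(t) = (1 / θᴵ) exp (-(bᴵ + ρᴵ)(T - t))`. -/
def kappa (t : ℝ) : ℝ :=
  1 / M.thetaI * Real.exp (-(M.bI + M.rhoI) * (M.T - t))

/-- The purchasing region `{t ∈ [0, T] | c(t) ≤ κ(t)}` of the insurer's equilibrium reinsurance
law given the premium rate `c`. -/
def purchasingRegion (c : ℝ → ℝ) : Set ℝ :=
  {τ ∈ Icc 0 M.T | c τ ≤ M.kappa τ}

/-- Nonnegative premium rates on `[0, T]` for which the insurer's response is well defined: from
every time on, there is a first time at which she purchases, unless she never does. -/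
structure IsPremiumStrategy (c : ℝ → ℝ) : Prop where
  nonneg : ∀ t ∈ Icc 0 M.T, 0 ≤ c t
  exists_first : ∀ t ∈ Icc 0 M.T, (M.purchasingRegion c ∩ Icc t M.T).Nonempty →
    ∃ τ, IsLeast (M.purchasingRegion c ∩ Icc t M.T) τ

open Classical in
/-- The first time in the set `A` of times that lies in the purchasing region, `⊤` if there is
none. -/
def firstPurchase (c : ℝ → ℝ) (A : Set ℝ) : WithTop ℝ :=
  if (M.purchasingRegion c ∩ A).Nonempty then
    ((sInf (M.purchasingRegion c ∩ A) : ℝ) : WithTop ℝ)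
  else ⊤

/-- The purchasing time `p(t; c) = min {τ ∈ [t, T] | c(τ) ≤ κ(τ)}`. -/
def purchasingTime (c : ℝ → ℝ) (t : ℝ) : WithTop ℝ :=
  M.firstPurchase c (Icc t M.T)

/-- The perturbed purchasing time `pʰ(t; c)`, where the times in `[t, t + h)` cannot be
selected. -/
def perturbedTime (c : ℝ → ℝ) (t h : ℝ) : WithTop ℝ :=
  M.firstPurchase c (Icc t M.T \ Ico t (t + h))

open Classical in
/-- The coverage path that starts from `y` and jumps to the ceiling at time `p`; it has left limit
`y` at the initial time whenever `p` is not earlier than the initial time. -/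
def fullPurchaseAt {Ω : Type*} (y : ℝ) (p : WithTop ℝ) : ℝ → Ω → ℝ :=
  fun r _ => if p ≤ (r : WithTop ℝ) then M.ybar else y

/-- The insurer's equilibrium reinsurance strategy started at `(x, t, y)`, given the premium rate
`c`: she purchases the remaining coverage at the first time in the purchasing region. -/
def insurerResponse {Ω : Type*} (_x t y : ℝ) (c : ℝ → ℝ) : ℝ → Ω → ℝ :=
  M.fullPurchaseAt y (M.purchasingTime c t)

end Model

open Classical in
/-- The Lebesgue–Stieltjes integral `∫_{[t, T]} f dξ` against a nondecreasing right-continuous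
path, jumps at both end points included. The jump at `t` is measured from the left limit of `ξ`
at `t`. -/
def stieltjesIntegral (f ξ : ℝ → ℝ) (t T : ℝ) : ℝ :=
  if hξ : Monotone ξ then ∫ r in Icc t T, f r ∂hξ.stieltjesFunction.measure else 0

variable {Ω : Type*} [MeasurableSpace Ω]

/-- `Z` solves, almost surely on `[t, T]`,
`dZ_r = (aᴿ - bᴿ Z_r) dr + σᴿ dB_r + dξ_r` with `Z_{t-} = z` and `ξ_{t-} = y`.
The noise is additive, so the equation in integral form involves no stochastic integral, and it
determines `Z` on `[t, T]` up to indistinguishability. -/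
def IsExposure (M : Model) (B : ℝ≥0 → Ω → ℝ) (μ : Measure Ω) (t y z : ℝ)
    (ξ Z : ℝ → Ω → ℝ) : Prop :=
  ∀ᵐ ω ∂μ, IntervalIntegrable (fun u => Z u ω) volume t M.T ∧
    ∀ r ∈ Icc t M.T,
      Z r ω = z + (∫ u in t..r, (M.aR - M.bR * Z u ω))
        + M.sigmaR * (B r.toNNReal ω - B t.toNNReal ω) + (ξ r ω - y)

open Classical in
/-- The reinsurer's controlled exposure `Z^ξ` started at time `t` from `z`. -/
def exposure (M : Model) (B : ℝ≥0 → Ω → ℝ) (μ : Measure Ω) (t y z : ℝ)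
    (ξ : ℝ → Ω → ℝ) : ℝ → Ω → ℝ :=
  if h : ∃ Z, IsExposure M B μ t y z ξ Z then h.choose else 0

/-- The reinsurer's cost functional for coverage process `ξ` and premium rate `c`:
`E Z_T + γᴿ Var Z_T - θᴿ E ∫_{[t, T]} exp (ρᴿ (T - r)) c(r) dξ_r`. -/
def cost (M : Model) (B : ℝ≥0 → Ω → ℝ) (μ : Measure Ω) (t y z : ℝ)
    (ξ : ℝ → Ω → ℝ) (c : ℝ → ℝ) : ℝ :=
  (∫ ω, exposure M B μ t y z ξ M.T ω ∂μ)
    + M.gammaR * variance (exposure M B μ t y z ξ M.T) μ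
    - M.thetaR * ∫ ω, stieltjesIntegral (fun r => Real.exp (M.rhoR * (M.T - r)) * c r)
        (fun r => ξ r ω) t M.T ∂μ

/-- The reinsurer's objective `Jᴿ(x, t, y, z; c)`: his cost when the insurer responds to `c`. -/
def objective (M : Model) (B : ℝ≥0 → Ω → ℝ) (μ : Measure Ω) (x t y z : ℝ) (c : ℝ → ℝ) : ℝ :=
  cost M B μ t y z (M.insurerResponse x t y c) c

/-- The objective `K(t, y, z, p)` of the time-selection problem: the reinsurer's cost when the
remaining coverage is transferred to him at time `p` at the premium rate `κ(p)`. A time `p` after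
the horizon, in particular `p = ⊤`, means that nothing is transferred. -/
def timeObjective (M : Model) (B : ℝ≥0 → Ω → ℝ) (μ : Measure Ω) (t y z : ℝ)
    (p : WithTop ℝ) : ℝ :=
  cost M B μ t y z (M.fullPurchaseAt y p) M.kappa

open Classical in
/-- The premium rate that follows `c'` on `[t, t + h)` and `c` at all other times. -/
def perturbedPremium (c c' : ℝ → ℝ) (t h : ℝ) : ℝ → ℝ :=
  fun r => if r ∈ Ico t (t + h) then c' r else c r

/-- Equilibrium premium strategies of the reinsurer. The lower limit is taken in the extended
real numbers. -/
structure IsEquilibriumPremium (M : Model) (B : ℝ≥0 → Ω → ℝ) (μ : Measure Ω)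
    (c : ℝ → ℝ) : Prop where
  interior : ∀ x z : ℝ, ∀ t ∈ Ico 0 M.T, ∀ y ∈ Icc 0 M.ybar,
    ∀ c' : ℝ → ℝ, M.IsPremiumStrategy c' →
      0 ≤ liminf (fun h : ℝ =>
        (((objective M B μ x t y z (perturbedPremium c c' t h)
          - objective M B μ x t y z c) / h : ℝ) : EReal)) (𝓝[>] 0)
  terminal : ∀ x z : ℝ, ∀ y ∈ Icc 0 M.ybar,
    ∀ c' : ℝ → ℝ, M.IsPremiumStrategy c' →
      0 ≤ objective M B μ x M.T y z c' - objective M B μ x M.T y z c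

/-- The purchasing time `p(t; c)` is an equilibrium selected time of the reinsurer's
time-selection problem. The limit exists in the extended real numbers and is nonnegative. -/
structure IsEquilibriumSelectedTime (M : Model) (B : ℝ≥0 → Ω → ℝ) (μ : Measure Ω)
    (c : ℝ → ℝ) : Prop where
  no_worse_than_now : ∀ t ∈ Icc 0 M.T, ∀ y ∈ Icc 0 M.ybar, ∀ z : ℝ,
    timeObjective M B μ t y z (M.purchasingTime c t) ≤ timeObjective M B μ t y z (t : WithTop ℝ)
  no_worse_than_delay : ∀ t ∈ Icc 0 M.T, ∀ y ∈ Icc 0 M.ybar, ∀ z : ℝ,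
    ∃ L : EReal, 0 ≤ L ∧ Tendsto (fun h : ℝ =>
      (((timeObjective M B μ t y z (M.perturbedTime c t h)
        - timeObjective M B μ t y z (M.purchasingTime c t)) / h : ℝ) : EReal)) (𝓝[>] 0) (𝓝 L)

end Reinsurance

end

/-! The exposure equation is linear with additive noise, so a purchase at a deterministic time `p`
shifts the terminal exposure by a deterministic amount and leaves its variance unchanged. By
`exists_cost_fullPurchaseAt_eq` the cost is therefore affine in the coverage transferred, with slope
`M.unitCost c p`, and both equilibrium notions become statements about this deterministic function
of time.

A rate perturbed on `[t, t + h)` has, for small `h`, only two possible effects: a purchase at once,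
at a rate at most `κ(t)`, or a purchase postponed to the first one after `t + h`. These are the two
comparisons in the time-selection problem. Conversely, testing with the rate `κ` gives the
comparison with buying now and forces `c = κ` on the purchasing region, and testing with `κ + 1`,
which is never accepted, gives the comparison with delay.

The remaining gap is between a liminf and a limit. `exists_tendsto_delay` closes it: the unit cost
at rate `κ` is strictly increasing or nonincreasing just after any time, and in each case the
inequality for buying now or the sign of the quotients forces convergence. -/

noncomputable section

namespace Reinsurance

/-! ### Linear Volterra equations whose forcing term may jump. -/

/-- Variation of constants: a solution of `Z r = g r - b ∫_t^r Z` is determined at the end point by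
the forcing term `g`, which is allowed to jump at countably many times. -/
lemma linear_volterra_terminal {t T b : ℝ} (htT : t ≤ T) {g Z : ℝ → ℝ} {s : Set ℝ}
    (hs : s.Countable) (hg : ∀ r ∈ Ioo t T \ s, ContinuousAt g r)
    (hgi : IntervalIntegrable g volume t T) (hZi : IntervalIntegrable Z volume t T)
    (hZ : ∀ r ∈ Icc t T, Z r = g r - b * ∫ u in t..r, Z u) :
    Z T = g T - b * ∫ u in t..T, Real.exp (-b * (T - u)) * g u := by
  have hV : ContinuousOn (fun r => ∫ u in t..r, Z u) (Icc t T) := by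
    have := intervalIntegral.continuousOn_primitive_interval' (a := t) hZi (by simp)
    rwa [uIcc_of_le htT] at this
  -- Integrating factor: `V r = ∫_t^r Z` satisfies `V' = g - b V` off `s`, so `exp (-b (T - r)) V r`
  -- has derivative `exp (-b (T - r)) g r`. At `r = T` the factor is `1`.
  have key := MeasureTheory.integral_eq_of_hasDerivAt_off_countable_of_le
    (fun r => Real.exp (-b * (T - r)) * ∫ u in t..r, Z u)
    (fun r => Real.exp (-b * (T - r)) * g r) htT hs ?_ ?_ ?_
  · rw [key, hZ T (right_mem_Icc.2 htT)]
    simp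
  · exact (by fun_prop : Continuous fun r => Real.exp (-b * (T - r))).continuousOn.mul hV
  · intro r hr
    have hrI : Icc t T ∈ 𝓝 r := Icc_mem_nhds hr.1.1 hr.1.2
    have hZc : ContinuousAt Z r := by
      have h1 : ContinuousAt (fun r => g r - b * ∫ u in t..r, Z u) r :=
        (hg r hr).sub (continuousAt_const.mul (hV.continuousAt hrI))
      refine h1.congr ?_
      filter_upwards [hrI] with x hx using (hZ x hx).symm
    have hVd : HasDerivAt (fun r => ∫ u in t..r, Z u) (Z r) r := by
      refine intervalIntegral.integral_hasDerivAt_right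
        (hZi.mono_set ?_) ?_ hZc
      · rw [uIcc_of_le hr.1.1.le, uIcc_of_le htT]
        exact Icc_subset_Icc_right hr.1.2.le
      · refine ⟨Ioc t T, Ioc_mem_nhds hr.1.1 hr.1.2, ?_⟩
        exact ((intervalIntegrable_iff_integrableOn_Ioc_of_le htT).1 hZi).aestronglyMeasurable
    have hE : HasDerivAt (fun r => Real.exp (-b * (T - r))) (Real.exp (-b * (T - r)) * b) r := by
      have : HasDerivAt (fun r => -b * (T - r)) b r := by
        simpa using ((hasDerivAt_id r).const_sub T).const_mul (-b)
      exact this.exp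
    refine (hE.mul hVd).congr_deriv ?_
    rw [hZ r ⟨hr.1.1.le, hr.1.2.le⟩]
    ring
  · exact hgi.continuousOn_mul (by fun_prop)

/-- The variation of constants formula does solve `Z r = g r - b ∫_t^r Z`. -/
lemma linear_volterra_exists {t T b : ℝ} (htT : t ≤ T) {g : ℝ → ℝ} {s : Set ℝ}
    (hs : s.Countable) (hg : ∀ r ∈ Ioo t T \ s, ContinuousAt g r)
    (hgi : IntervalIntegrable g volume t T) :
    ∃ Z : ℝ → ℝ, IntervalIntegrable Z volume t T ∧
      ∀ r ∈ Icc t T, Z r = g r - b * ∫ u in t..r, Z u := by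
  have hhi : IntervalIntegrable (fun u => Real.exp (b * u) * g u) volume t T :=
    hgi.continuousOn_mul (by fun_prop)
  -- `V` solves `V' = g - b V`, `V t = 0`, so it is the primitive that the integral of the solution
  -- `g - b V` must equal.
  set V : ℝ → ℝ := fun r => Real.exp (-b * r) * ∫ u in t..r, Real.exp (b * u) * g u with hVdef
  have hVc : ContinuousOn V (Icc t T) := by
    have := intervalIntegral.continuousOn_primitive_interval' (a := t) hhi (by simp)
    rw [uIcc_of_le htT] at this
    exact (by fun_prop : Continuous fun r => Real.exp (-b * r)).continuousOn.mul this
  have hZi : IntervalIntegrable (fun r => g r - b * V r) volume t T := by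
    refine hgi.sub (IntervalIntegrable.const_mul ?_ b)
    refine ContinuousOn.intervalIntegrable ?_
    rwa [uIcc_of_le htT]
  refine ⟨fun r => g r - b * V r, hZi, fun r hr => ?_⟩
  have hsub : uIcc t r ⊆ uIcc t T := by
    rw [uIcc_of_le hr.1, uIcc_of_le htT]
    exact Icc_subset_Icc_right hr.2
  have key := MeasureTheory.integral_eq_of_hasDerivAt_off_countable_of_le
    V (fun r => g r - b * V r) hr.1 hs (hVc.mono (Icc_subset_Icc_right hr.2)) ?_
    (hZi.mono_set hsub)
  · rw [key]
    simp [hVdef]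
  · intro q hq
    have hqT : q < T := hq.1.2.trans_le hr.2
    have hVd : HasDerivAt (fun r => ∫ u in t..r, Real.exp (b * u) * g u)
        (Real.exp (b * q) * g q) q := by
      refine intervalIntegral.integral_hasDerivAt_right (hhi.mono_set ?_) ?_ ?_
      · rw [uIcc_of_le hq.1.1.le, uIcc_of_le htT]
        exact Icc_subset_Icc_right hqT.le
      · refine ⟨Ioc t T, Ioc_mem_nhds hq.1.1 hqT, ?_⟩
        exact ((intervalIntegrable_iff_integrableOn_Ioc_of_le htT).1 hhi).aestronglyMeasurable
      · exact (by fun_prop : ContinuousAt (fun u => Real.exp (b * u)) q).mul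
          (hg q ⟨⟨hq.1.1, hqT⟩, hq.2⟩)
    have hE : HasDerivAt (fun r => Real.exp (-b * r)) (Real.exp (-b * q) * -b) q := by
      have : HasDerivAt (fun r => -b * r) (-b) q := by
        simpa using (hasDerivAt_id q).const_mul (-b)
      exact this.exp
    refine (hE.mul hVd).congr_deriv ?_
    have : Real.exp (-b * q) * Real.exp (b * q) = 1 := by
      rw [← Real.exp_add]; simp
    simp only [hVdef]
    linear_combination (g q) * this

/-- The exponentially weighted effect at time `T` of a unit jump at time `p`. -/
lemma terminal_effect_of_jump {t T b p k : ℝ} (hb : b ≠ 0) (htp : t ≤ p) (hpT : p ≤ T) :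
    k - b * ∫ u in t..T, Real.exp (-b * (T - u)) * (if p ≤ u then k else 0)
      = k * Real.exp (-b * (T - p)) := by
  have h1 : ∫ u in t..T, Real.exp (-b * (T - u)) * (if p ≤ u then k else 0)
      = ∫ u in p..T, Real.exp (-b * (T - u)) * k := by
    have hi : ∀ a c, IntervalIntegrable
        (fun u => Real.exp (-b * (T - u)) * (if p ≤ u then k else 0)) volume a c := by
      intro a c
      refine IntervalIntegrable.continuousOn_mul ?_ (by fun_prop)
      by_cases hk : 0 ≤ k
      · refine Monotone.intervalIntegrable fun x y hxy => ?_
        split_ifs <;> linarith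
      · refine Antitone.intervalIntegrable fun x y hxy => ?_
        split_ifs <;> linarith
    rw [← intervalIntegral.integral_add_adjacent_intervals (hi t p) (hi p T)]
    have h2 : ∫ u in t..p, Real.exp (-b * (T - u)) * (if p ≤ u then k else 0) = 0 := by
      refine intervalIntegral.integral_zero_ae ?_
      have : ∀ᵐ u : ℝ, u ≠ p := by simp [ae_iff]
      filter_upwards [this] with u hu hu'
      rw [uIoc_of_le htp] at hu'
      rw [if_neg (not_le.2 (lt_of_le_of_ne hu'.2 hu)), mul_zero]
    rw [h2, zero_add]
    refine intervalIntegral.integral_congr fun u hu => ?_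
    rw [uIcc_of_le hpT] at hu
    simp [hu.1]
  have h3 : ∫ u in p..T, Real.exp (-b * (T - u)) * k
      = Real.exp (-b * (T - T)) * k / b - Real.exp (-b * (T - p)) * k / b := by
    refine intervalIntegral.integral_eq_sub_of_hasDerivAt (f := fun u =>
      Real.exp (-b * (T - u)) * k / b) (fun u _ => ?_)
      (Continuous.intervalIntegrable (by fun_prop) _ _)
    have : HasDerivAt (fun r => -b * (T - r)) b u := by
      simpa using ((hasDerivAt_id u).const_sub T).const_mul (-b)
    refine ((this.exp.mul_const k).div_const b).congr_deriv ?_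
    field_simp
  rw [h1, h3]
  field_simp
  simp

/-! ### Stieltjes integrals against a path with at most one jump. -/

lemma monotone_jump {y k : ℝ} (hyk : y ≤ k) (p : ℝ) :
    Monotone (fun r : ℝ => if p ≤ r then k else y) := by
  intro x z hxz
  dsimp only
  split_ifs <;> linarith [hyk]

/-- The Lebesgue–Stieltjes measure of a single jump is a point mass. -/
lemma measure_stieltjesFunction_jump {y k p : ℝ}
    (hm : Monotone (fun r : ℝ => if p ≤ r then k else y)) :
    hm.stieltjesFunction.measure = ENNReal.ofReal (k - y) • Measure.dirac p := by
  have hval : ∀ x, hm.stieltjesFunction x = if p ≤ x then k else y := by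
    intro x
    rw [Monotone.stieltjesFunction_eq]
    refine ContinuousWithinAt.rightLim_eq ?_
    by_cases h : p ≤ x
    · rw [ContinuousWithinAt, if_pos h]
      refine tendsto_const_nhds.congr' ?_
      filter_upwards [self_mem_nhdsWithin] with u hu
      rw [if_pos (h.trans hu)]
    · rw [ContinuousWithinAt, if_neg h]
      refine tendsto_const_nhds.congr' ?_
      filter_upwards [mem_nhdsWithin_of_mem_nhds (Iio_mem_nhds (not_le.1 h))] with u hu
      rw [if_neg (not_le.2 hu)]
  refine Measure.ext_of_Ioc _ _ fun a b hab => ?_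
  rw [StieltjesFunction.measure_Ioc, hval, hval]
  by_cases h1 : p ≤ a
  · simp [h1, h1.trans hab.le]
  · by_cases h2 : p ≤ b
    · simp [h1, h2, not_le.1 h1]
    · simp [h1, h2]

lemma stieltjesIntegral_jump {y k p t T : ℝ} (hyk : y ≤ k) (hp : p ∈ Icc t T) (f : ℝ → ℝ) :
    stieltjesIntegral f (fun r : ℝ => if p ≤ r then k else y) t T = f p * (k - y) := by
  have hm := monotone_jump hyk p
  rw [stieltjesIntegral, dif_pos hm, measure_stieltjesFunction_jump hm,
    Measure.restrict_smul, integral_smul_measure, restrict_dirac' measurableSet_Icc,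
    if_pos hp, integral_dirac, ENNReal.toReal_ofReal (by linarith)]
  simp [mul_comm]

lemma stieltjesIntegral_const {y t T : ℝ} (f : ℝ → ℝ) :
    stieltjesIntegral f (fun _ => y) t T = 0 := by
  have hm : Monotone (fun _ : ℝ => y) := monotone_const
  have h : hm.stieltjesFunction = StieltjesFunction.const ℝ y := by
    ext x
    rw [Monotone.stieltjesFunction_eq, StieltjesFunction.const_apply]
    exact ContinuousWithinAt.rightLim_eq continuousWithinAt_const
  rw [stieltjesIntegral, dif_pos hm, h, StieltjesFunction.measure_const]
  simp

/-! ### Integrability of time integrals of Brownian motion. -/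

/-- A process with almost surely continuous paths is jointly measurable up to null sets. -/
lemma aestronglyMeasurable_uncurry_of_continuous_paths {Ω : Type*} [MeasurableSpace Ω]
    {μ : Measure Ω} [SFinite μ] {B : ℝ≥0 → Ω → ℝ}
    (hmeas : ∀ t, AEMeasurable (B t) μ) (hcont : ∀ᵐ ω ∂μ, Continuous (B · ω))
    (ν : Measure ℝ) [SFinite ν] :
    AEStronglyMeasurable (fun q : ℝ × Ω => B q.1.toNNReal q.2) (ν.prod μ) := by
  have hsnd : ∀ {P : Ω → Prop}, (∀ᵐ ω ∂μ, P ω) → ∀ᵐ q : ℝ × Ω ∂(ν.prod μ), P q.2 :=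
    fun h => Measure.quasiMeasurePreserving_snd.ae h
  -- Time is rounded down to the grid of mesh `1 / (n + 1)`. Each approximation involves only
  -- countably many variables `B s`, and path continuity gives convergence.
  refine aestronglyMeasurable_of_tendsto_ae atTop (μ := ν.prod μ)
    (f := fun (n : ℕ) (q : ℝ × Ω) =>
      B ((⌊((n : ℝ) + 1) * (q.1.toNNReal : ℝ)⌋₊ : ℝ≥0) / ((n : ℝ≥0) + 1)) q.2) ?_ ?_
  · intro n
    have hm : Measurable (fun q : ℕ × Ω => (hmeas ((q.1 : ℝ≥0) / ((n : ℝ≥0) + 1))).mk _ q.2) :=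
      measurable_from_prod_countable_right fun k =>
        (hmeas ((k : ℝ≥0) / ((n : ℝ≥0) + 1))).measurable_mk
    have hfl : Measurable (fun q : ℝ × Ω => ⌊((n : ℝ) + 1) * (q.1.toNNReal : ℝ)⌋₊) :=
      Nat.measurable_floor.comp (by fun_prop)
    refine ⟨_, (hm.comp (hfl.prodMk measurable_snd)).stronglyMeasurable, ?_⟩
    have hall : ∀ᵐ ω ∂μ, ∀ k : ℕ, B ((k : ℝ≥0) / ((n : ℝ≥0) + 1)) ω
        = (hmeas ((k : ℝ≥0) / ((n : ℝ≥0) + 1))).mk _ ω :=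
      ae_all_iff.2 fun k => (hmeas _).ae_eq_mk
    filter_upwards [hsnd hall] with q hq
    exact hq _
  · filter_upwards [hsnd hcont] with q hq
    refine (hq.tendsto _).comp ?_
    have h := (tendsto_nat_floor_mul_div_atTop (R := ℝ) (a := q.1.toNNReal)
      NNReal.zero_le_coe).comp
      (tendsto_atTop_add_const_right atTop (1 : ℝ) (tendsto_natCast_atTop_atTop (R := ℝ)))
    rw [← NNReal.tendsto_coe]
    refine h.congr fun n => ?_
    simp [mul_comm]

lemma integral_abs_brownian_le {Ω : Type*} [MeasurableSpace Ω]
    {μ : Measure Ω} [IsProbabilityMeasure μ] {B : ℝ≥0 → Ω → ℝ} (hB : IsBrownianReal B μ) (s : ℝ≥0) :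
    ∫ ω, |B s ω| ∂μ ≤ 1 + s := by
  have hL2 : MemLp (B s) 2 μ := (hB.isGaussianProcess.hasGaussianLaw_eval s).memLp_two
  have hsq : ∫ ω, (B s ω) ^ 2 ∂μ = s := by
    have h := hB.covariance_eval s s
    rw [covariance_eq_sub hL2 hL2, hB.integral_eval] at h
    simpa [sq] using h
  calc ∫ ω, |B s ω| ∂μ ≤ ∫ ω, (1 + (B s ω) ^ 2) ∂μ := by
        refine integral_mono (hB.integrable_eval s).abs
          ((integrable_const 1).add hL2.integrable_sq) fun ω => ?_
        dsimp only
        nlinarith [sq_nonneg (|B s ω| - 1), sq_abs (B s ω), abs_nonneg (B s ω)]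
    _ = 1 + s := by
        rw [integral_add (integrable_const 1) hL2.integrable_sq, hsq]
        simp

/-- Weighted time integrals of Brownian paths are integrable random variables. -/
lemma integrable_intervalIntegral_brownian {Ω : Type*} [MeasurableSpace Ω]
    {μ : Measure Ω} [IsProbabilityMeasure μ] {B : ℝ≥0 → Ω → ℝ} (hB : IsBrownianReal B μ)
    {t T : ℝ} (htT : t ≤ T) {w : ℝ → ℝ} (hw : Continuous w) :
    Integrable (fun ω => ∫ u in t..T, w u * B u.toNNReal ω) μ := by
  simp_rw [intervalIntegral.integral_of_le htT]
  suffices h : Integrable (fun q : ℝ × Ω => w q.1 * B q.1.toNNReal q.2)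
      ((volume.restrict (Ioc t T)).prod μ) from h.integral_prod_right
  have hm : AEStronglyMeasurable (fun q : ℝ × Ω => w q.1 * B q.1.toNNReal q.2)
      ((volume.restrict (Ioc t T)).prod μ) :=
    (hw.measurable.comp measurable_fst).aestronglyMeasurable.mul
      (aestronglyMeasurable_uncurry_of_continuous_paths hB.aemeasurable hB.cont _)
  refine (integrable_prod_iff hm).2 ⟨ae_of_all _ fun u =>
    (hB.integrable_eval u.toNNReal).const_mul (w u), ?_⟩
  have hdom : Integrable (fun u : ℝ => |w u| * (1 + (u.toNNReal : ℝ)))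
      (volume.restrict (Ioc t T)) :=
    IntegrableOn.mono_set (ContinuousOn.integrableOn_Icc (by fun_prop)) Ioc_subset_Icc_self
  refine hdom.mono' hm.norm.integral_prod_right' (ae_of_all _ fun u => ?_)
  rw [Real.norm_of_nonneg (by positivity)]
  simp only [norm_mul, Real.norm_eq_abs]
  rw [integral_const_mul]
  exact mul_le_mul_of_nonneg_left (integral_abs_brownian_le hB _) (abs_nonneg _)

/-! ### Reduction of the cost functional to a deterministic unit cost. -/

/-- The effect on the reinsurer's cost of taking over one unit of coverage at time `p` at the
rate `c p`, as compared to taking over nothing, which is what `p = ⊤` stands for. -/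
def Model.unitCost (M : Model) (c : ℝ → ℝ) : WithTop ℝ → ℝ :=
  WithTop.recTopCoe 0 fun p =>
    Real.exp (-M.bR * (M.T - p)) - M.thetaR * (Real.exp (M.rhoR * (M.T - p)) * c p)

@[simp] lemma Model.unitCost_top (M : Model) (c : ℝ → ℝ) : M.unitCost c ⊤ = 0 := rfl

lemma Model.unitCost_coe (M : Model) (c : ℝ → ℝ) (p : ℝ) : M.unitCost c (p : WithTop ℝ) =
    Real.exp (-M.bR * (M.T - p)) - M.thetaR * (Real.exp (M.rhoR * (M.T - p)) * c p) := rfl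

lemma Model.fullPurchaseAt_top (M : Model) {Ω : Type*} (y : ℝ) :
    (M.fullPurchaseAt y ⊤ : ℝ → Ω → ℝ) = fun _ _ => y := by
  funext r ω
  simp [Model.fullPurchaseAt]

lemma Model.fullPurchaseAt_coe (M : Model) {Ω : Type*} (y p : ℝ) :
    (M.fullPurchaseAt y (p : WithTop ℝ) : ℝ → Ω → ℝ) = fun r _ => if p ≤ r then M.ybar else y := by
  funext r ω
  simp [Model.fullPurchaseAt]

/-- The terminal exposure is determined by the forcing term of its equation. -/
lemma exposure_terminal_ae (M : Model) {Ω : Type*} [MeasurableSpace Ω] {μ : Measure Ω}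
    {B : ℝ≥0 → Ω → ℝ} (hcont : ∀ᵐ ω ∂μ, Continuous (B · ω)) {t y z : ℝ} (htT : t ≤ M.T)
    {ξ : ℝ → ℝ} {s : Set ℝ} (hs : s.Countable) (hξ : ∀ r ∉ s, ContinuousAt ξ r)
    (hξi : IntervalIntegrable ξ volume t M.T) :
    ∀ᵐ ω ∂μ, exposure M B μ t y z (fun r _ => ξ r) M.T ω =
      (z + M.aR * (M.T - t) + M.sigmaR * (B M.T.toNNReal ω - B t.toNNReal ω)
        - M.bR * ∫ u in t..M.T, Real.exp (-M.bR * (M.T - u)) *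
          (z + M.aR * (u - t) + M.sigmaR * (B u.toNNReal ω - B t.toNNReal ω)))
      + (ξ M.T - y - M.bR * ∫ u in t..M.T, Real.exp (-M.bR * (M.T - u)) * (ξ u - y)) := by
  set g : Ω → ℝ → ℝ := fun ω r =>
    z + M.aR * (r - t) + M.sigmaR * (B r.toNNReal ω - B t.toNNReal ω) + (ξ r - y) with hg
  have hpath : ∀ ω, Continuous (B · ω) → Continuous fun r : ℝ =>
      z + M.aR * (r - t) + M.sigmaR * (B r.toNNReal ω - B t.toNNReal ω) := by
    intro ω hω
    have : Continuous fun r : ℝ => B r.toNNReal ω := hω.comp continuous_real_toNNReal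
    fun_prop
  have hgc : ∀ ω, Continuous (B · ω) → ∀ r ∈ Ioo t M.T \ s, ContinuousAt (g ω) r :=
    fun ω hω r hr => (hpath ω hω).continuousAt.add ((hξ r hr.2).sub continuousAt_const)
  have hξi' : IntervalIntegrable (fun r => ξ r - y) volume t M.T := hξi.sub intervalIntegrable_const
  have hgi : ∀ ω, Continuous (B · ω) → IntervalIntegrable (g ω) volume t M.T :=
    fun ω hω => ((hpath ω hω).intervalIntegrable _ _).add hξi'
  have hequiv : ∀ (f : ℝ → ℝ) ω, IntervalIntegrable f volume t M.T → ∀ r ∈ Icc t M.T,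
      z + (∫ u in t..r, (M.aR - M.bR * f u))
        + M.sigmaR * (B r.toNNReal ω - B t.toNNReal ω) + (ξ r - y)
      = g ω r - M.bR * ∫ u in t..r, f u := by
    intro f ω hf r hr
    have hfr : IntervalIntegrable f volume t r := hf.mono_set (by
      rw [uIcc_of_le hr.1, uIcc_of_le htT]; exact Icc_subset_Icc_right hr.2)
    rw [intervalIntegral.integral_sub intervalIntegrable_const (hfr.const_mul _),
      intervalIntegral.integral_const, intervalIntegral.integral_const_mul, hg]
    simp only [smul_eq_mul]
    ring
  -- Existence must be shown because `exposure` is `0` otherwise. Solutions may be chosen path by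
  -- path, since `IsExposure` asks for no measurability in `ω`.
  have hex : ∃ Z, IsExposure M B μ t y z (fun r _ => ξ r) Z := by
    have : ∀ ω, ∃ f : ℝ → ℝ, Continuous (B · ω) → IntervalIntegrable f volume t M.T ∧
        ∀ r ∈ Icc t M.T, f r = g ω r - M.bR * ∫ u in t..r, f u := by
      intro ω
      by_cases hω : Continuous (B · ω)
      · obtain ⟨f, hf⟩ := linear_volterra_exists (b := M.bR) htT hs (hgc ω hω) (hgi ω hω)
        exact ⟨f, fun _ => hf⟩
      · exact ⟨0, fun h => absurd h hω⟩
    choose f hf using this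
    refine ⟨fun r ω => f ω r, ?_⟩
    filter_upwards [hcont] with ω hω
    refine ⟨(hf ω hω).1, fun r hr => ?_⟩
    rw [hequiv (f ω) ω (hf ω hω).1 r hr]
    exact (hf ω hω).2 r hr
  have hsol : IsExposure M B μ t y z (fun r _ => ξ r) (exposure M B μ t y z (fun r _ => ξ r)) := by
    rw [exposure, dif_pos hex]
    exact hex.choose_spec
  filter_upwards [hcont, hsol] with ω hω hZ
  have h := linear_volterra_terminal (b := M.bR) htT hs (hgc ω hω) (hgi ω hω) hZ.1
    fun r hr => by rw [hZ.2 r hr, hequiv _ ω hZ.1 r hr]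
  rw [h]
  have hE : ContinuousOn (fun u => Real.exp (-M.bR * (M.T - u))) (uIcc t M.T) := by fun_prop
  have hsplit : ∫ u in t..M.T, Real.exp (-M.bR * (M.T - u)) * g ω u
      = (∫ u in t..M.T, Real.exp (-M.bR * (M.T - u)) *
          (z + M.aR * (u - t) + M.sigmaR * (B u.toNNReal ω - B t.toNNReal ω)))
        + ∫ u in t..M.T, Real.exp (-M.bR * (M.T - u)) * (ξ u - y) := by
    rw [← intervalIntegral.integral_add
      (((hpath ω hω).intervalIntegrable _ _).continuousOn_mul hE) (hξi'.continuousOn_mul hE)]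
    refine intervalIntegral.integral_congr fun u _ => ?_
    simp only [hg]
    ring
  rw [hsplit, hg]
  ring

/-- Needed for the expectation to split: were this variable not integrable, its integral would
default to `0` and a deterministic shift would not show in it. -/
lemma integrable_uncontrolled_exposure (M : Model) {Ω : Type*} [MeasurableSpace Ω]
    {μ : Measure Ω} [IsProbabilityMeasure μ] {B : ℝ≥0 → Ω → ℝ} (hB : IsBrownianReal B μ)
    {t : ℝ} (z : ℝ) (htT : t ≤ M.T) :
    Integrable (fun ω => z + M.aR * (M.T - t)
      + M.sigmaR * (B M.T.toNNReal ω - B t.toNNReal ω)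
        - M.bR * ∫ u in t..M.T, Real.exp (-M.bR * (M.T - u)) *
          (z + M.aR * (u - t) + M.sigmaR * (B u.toNNReal ω - B t.toNNReal ω))) μ := by
  have hi : Integrable (fun ω => ∫ u in t..M.T, Real.exp (-M.bR * (M.T - u)) *
      (z + M.aR * (u - t) + M.sigmaR * (B u.toNNReal ω - B t.toNNReal ω))) μ := by
    have h1 := (integrable_intervalIntegral_brownian hB htT
      (w := fun u => Real.exp (-M.bR * (M.T - u))) (by fun_prop)).const_mul M.sigmaR
    have h2 := (hB.integrable_eval t.toNNReal).const_mul
      (M.sigmaR * ∫ u in t..M.T, Real.exp (-M.bR * (M.T - u)))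
    have h3 : Integrable (fun _ : Ω => ∫ u in t..M.T, Real.exp (-M.bR * (M.T - u)) *
      (z + M.aR * (u - t))) μ := integrable_const _
    refine ((h3.add h1).sub h2).congr ?_
    filter_upwards [hB.cont] with ω hω
    have hBω : Continuous fun r : ℝ => B r.toNNReal ω := hω.comp continuous_real_toNNReal
    simp only [Pi.add_apply, Pi.sub_apply]
    have e2 : M.sigmaR * (∫ u in t..M.T, Real.exp (-M.bR * (M.T - u))) * B t.toNNReal ω
        = ∫ u in t..M.T, (M.sigmaR * B t.toNNReal ω) * Real.exp (-M.bR * (M.T - u)) := by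
      rw [intervalIntegral.integral_const_mul]
      ring
    rw [e2, ← intervalIntegral.integral_const_mul, ← intervalIntegral.integral_add,
      ← intervalIntegral.integral_sub]
    · refine intervalIntegral.integral_congr fun u _ => ?_
      ring
    all_goals exact Continuous.intervalIntegrable (by fun_prop) _ _
  exact (((integrable_const _).add (((hB.integrable_eval _).sub
    (hB.integrable_eval _)).const_mul _))).sub (hi.const_mul _)

/-- The cost of a deterministic full purchase is affine in the coverage that is transferred. -/
theorem exists_cost_fullPurchaseAt_eq (M : Model) {Ω : Type*} [MeasurableSpace Ω]
    {μ : Measure Ω} [IsProbabilityMeasure μ] {B : ℝ≥0 → Ω → ℝ} (hB : IsBrownianReal B μ)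
    {t y : ℝ} (z : ℝ) (htT : t ≤ M.T) (hy : y ≤ M.ybar) :
    ∃ J₀ : ℝ, ∀ (p : WithTop ℝ) (c : ℝ → ℝ), (p = ⊤ ∨ ∃ q ∈ Icc t M.T, p = (q : WithTop ℝ)) →
      cost M B μ t y z (M.fullPurchaseAt y p) c = J₀ + (M.ybar - y) * M.unitCost c p := by
  have hN := integrable_uncontrolled_exposure M hB z htT
  set N : Ω → ℝ := fun ω => z + M.aR * (M.T - t)
      + M.sigmaR * (B M.T.toNNReal ω - B t.toNNReal ω)
        - M.bR * ∫ u in t..M.T, Real.exp (-M.bR * (M.T - u)) *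
          (z + M.aR * (u - t) + M.sigmaR * (B u.toNNReal ω - B t.toNNReal ω)) with hNdef
  -- A constant shift `k` enters the mean only. The variance of `N` is never computed, as it cancels
  -- in every comparison.
  have hmoments : ∀ (Z : Ω → ℝ) (k : ℝ), (∀ᵐ ω ∂μ, Z ω = N ω + k) →
      (∫ ω, Z ω ∂μ) + M.gammaR * variance Z μ
        = ((∫ ω, N ω ∂μ) + M.gammaR * variance N μ) + k := by
    intro Z k hZ
    rw [integral_congr_ae hZ, variance_congr hZ, variance_add_const hN.aestronglyMeasurable,
      integral_add hN (integrable_const _)]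
    simp
    ring
  refine ⟨(∫ ω, N ω ∂μ) + M.gammaR * variance N μ, ?_⟩
  rintro p c (rfl | ⟨q, hq, rfl⟩)
  · rw [M.fullPurchaseAt_top, cost]
    have h := exposure_terminal_ae M hB.cont (y := y) (z := z) (ξ := fun _ => y) htT
      countable_empty (fun r _ => continuousAt_const) intervalIntegrable_const
    rw [hmoments _ 0 (h.mono fun ω hω => by rw [hω, hNdef]; simp)]
    simp [stieltjesIntegral_const]
  · rw [M.fullPurchaseAt_coe, cost]
    have h := exposure_terminal_ae M hB.cont (y := y) (z := z)
      (ξ := fun r => if q ≤ r then M.ybar else y) htT (countable_singleton q) ?_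
      (monotone_jump hy q).intervalIntegrable
    · rw [hmoments _ ((M.ybar - y) * Real.exp (-M.bR * (M.T - q))) (h.mono fun ω hω => ?_)]
      · simp only [stieltjesIntegral_jump hy hq, integral_const, probReal_univ, one_smul,
          M.unitCost_coe]
        ring
      · rw [hω, hNdef, ← terminal_effect_of_jump M.bR_pos.ne' hq.1 hq.2, if_pos hq.2]
        congr 4
        funext u
        split_ifs <;> simp
    · intro r hr
      rcases lt_or_gt_of_ne (show r ≠ q from hr) with h | h
      · refine (continuousAt_const (y := y)).congr ?_
        filter_upwards [Iio_mem_nhds h] with u hu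
        rw [if_neg (not_le.2 hu)]
      · refine (continuousAt_const (y := M.ybar)).congr ?_
        filter_upwards [Ioi_mem_nhds h] with u hu
        rw [if_pos (le_of_lt hu)]

/-! ### Purchasing times and unit costs under perturbation. -/

namespace Model

variable (M : Model)

lemma kappa_pos (t : ℝ) : 0 < M.kappa t :=
  mul_pos (one_div_pos.2 M.thetaI_pos) (Real.exp_pos _)

lemma isPremiumStrategy_kappa : M.IsPremiumStrategy M.kappa where
  nonneg t _ := (M.kappa_pos t).le
  exists_first t ht _ := ⟨t, ⟨⟨ht, le_rfl⟩, left_mem_Icc.2 ht.2⟩, fun _ h => h.2.1⟩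

lemma purchasingRegion_kappa_add_one : M.purchasingRegion (fun t => M.kappa t + 1) = ∅ := by
  ext t
  simp [purchasingRegion]

/-- A rate that is never accepted. Used as a perturbation on `[t, t + h)`, it withholds exactly
these times from the insurer. -/
lemma isPremiumStrategy_kappa_add_one : M.IsPremiumStrategy fun t => M.kappa t + 1 where
  nonneg t _ := by linarith [M.kappa_pos t]
  exists_first t _ h := by
    rw [M.purchasingRegion_kappa_add_one] at h
    simp at h

lemma firstPurchase_eq_coe {c : ℝ → ℝ} {A : Set ℝ} {τ : ℝ}
    (h : IsLeast (M.purchasingRegion c ∩ A) τ) : M.firstPurchase c A = (τ : WithTop ℝ) := by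
  rw [firstPurchase, if_pos h.nonempty, h.csInf_eq]

lemma firstPurchase_eq_top {c : ℝ → ℝ} {A : Set ℝ} (h : M.purchasingRegion c ∩ A = ∅) :
    M.firstPurchase c A = ⊤ := by
  rw [firstPurchase, if_neg (by simp [h])]

lemma perturbedTime_eq (c : ℝ → ℝ) (t : ℝ) {h : ℝ} (hh : 0 < h) :
    M.perturbedTime c t h = M.purchasingTime c (t + h) := by
  have : Icc t M.T \ Ico t (t + h) = Icc (t + h) M.T := by
    ext u
    simp only [Set.mem_sdiff, mem_Icc, mem_Ico, not_and, not_lt]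
    exact ⟨fun hu => ⟨hu.2 hu.1.1, hu.1.2⟩, fun hu => ⟨⟨by linarith, hu.2⟩, fun _ => hu.1⟩⟩
  rw [perturbedTime, purchasingTime, this]

lemma purchasingTime_cases {c : ℝ → ℝ} (hc : M.IsPremiumStrategy c) {t : ℝ} (ht : 0 ≤ t) :
    (M.purchasingRegion c ∩ Icc t M.T = ∅ ∧ M.purchasingTime c t = ⊤) ∨
      ∃ τ : ℝ, IsLeast (M.purchasingRegion c ∩ Icc t M.T) τ ∧
        M.purchasingTime c t = (τ : WithTop ℝ) := by
  rcases (M.purchasingRegion c ∩ Icc t M.T).eq_empty_or_nonempty with h | h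
  · exact Or.inl ⟨h, M.firstPurchase_eq_top h⟩
  · have htT : t ≤ M.T := by
      obtain ⟨u, hu⟩ := h
      exact hu.2.1.trans hu.2.2
    obtain ⟨τ, hτ⟩ := hc.exists_first t ⟨ht, htT⟩ h
    exact Or.inr ⟨τ, hτ, M.firstPurchase_eq_coe hτ⟩

lemma purchasingTime_admissible {c : ℝ → ℝ} (hc : M.IsPremiumStrategy c) {t s : ℝ} (ht : 0 ≤ t)
    (hts : t ≤ s) :
    M.purchasingTime c s = ⊤ ∨ ∃ q ∈ Icc t M.T, M.purchasingTime c s = (q : WithTop ℝ) := by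
  rcases M.purchasingTime_cases hc (ht.trans hts) with h | ⟨τ, hτ, h⟩
  · exact Or.inl h.2
  · exact Or.inr ⟨τ, ⟨hts.trans hτ.1.2.1, hτ.1.2.2⟩, h⟩

lemma purchasingTime_of_mem {c : ℝ → ℝ} {t : ℝ} (ht : t ∈ M.purchasingRegion c) :
    M.purchasingTime c t = (t : WithTop ℝ) :=
  M.firstPurchase_eq_coe ⟨⟨ht, left_mem_Icc.2 ht.1.2⟩, fun _ h => h.2.1⟩

lemma purchasingTime_of_gt {c : ℝ → ℝ} {t : ℝ} (ht : M.T < t) : M.purchasingTime c t = ⊤ :=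
  M.firstPurchase_eq_top (by rw [Icc_eq_empty (not_le.2 ht), inter_empty])

/-- The purchasing time does not change along an interval without purchases. -/
lemma purchasingTime_congr {c : ℝ → ℝ} {s t : ℝ} (hst : s ≤ t)
    (h : ∀ u ∈ Ico s t, u ∉ M.purchasingRegion c) :
    M.purchasingTime c s = M.purchasingTime c t := by
  have : M.purchasingRegion c ∩ Icc s M.T = M.purchasingRegion c ∩ Icc t M.T := by
    ext u
    refine ⟨fun hu => ⟨hu.1, ?_, hu.2.2⟩, fun hu => ⟨hu.1, hst.trans hu.2.1, hu.2.2⟩⟩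
    by_contra hut
    exact h u ⟨hu.2.1, not_le.1 hut⟩ hu.1
  rw [purchasingTime, purchasingTime, firstPurchase, firstPurchase, this]

/-- The next purchase is attained as a minimum, hence lies strictly after `t`. With a mere infimum,
purchases could accumulate at `t`. -/
lemma purchasingTime_eventually_eq {c : ℝ → ℝ} (hc : M.IsPremiumStrategy c) {t : ℝ} (ht : 0 ≤ t)
    (htc : t ∉ M.purchasingRegion c) :
    ∃ δ > 0, ∀ u ∈ M.purchasingRegion c, t ≤ u → t + δ ≤ u := by
  rcases M.purchasingTime_cases hc ht with h | ⟨τ, hτ, -⟩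
  · refine ⟨1, one_pos, fun u hu htu => ?_⟩
    have : u ∈ M.purchasingRegion c ∩ Icc t M.T := ⟨hu, htu, hu.1.2⟩
    simp [h.1] at this
  · have hlt : t < τ := lt_of_le_of_ne hτ.1.2.1 fun h => htc (h ▸ hτ.1.1)
    refine ⟨τ - t, sub_pos.2 hlt, fun u hu htu => ?_⟩
    have := hτ.2 ⟨hu, htu, hu.1.2⟩
    linarith

/-- If the perturbing rate triggers a purchase at once, the insurer purchases at once. -/
lemma purchasingTime_perturbedPremium_of_mem {c c' : ℝ → ℝ} {t h : ℝ} (hh : 0 < h)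
    (ht : t ∈ M.purchasingRegion c') :
    M.purchasingTime (perturbedPremium c c' t h) t = (t : WithTop ℝ) := by
  refine M.purchasingTime_of_mem ⟨ht.1, ?_⟩
  rw [perturbedPremium, if_pos ⟨le_rfl, by linarith⟩]
  exact ht.2

/-- If the perturbing rate triggers no purchase, the purchase is delayed. -/
lemma purchasingTime_perturbedPremium_of_forall {c c' : ℝ → ℝ} {t h : ℝ} (hh : 0 < h)
    (hc' : ∀ u ∈ M.purchasingRegion c', t ≤ u → t + h ≤ u) :
    M.purchasingTime (perturbedPremium c c' t h) t = M.purchasingTime c (t + h) := by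
  have : M.purchasingRegion (perturbedPremium c c' t h) ∩ Icc t M.T
      = M.purchasingRegion c ∩ Icc (t + h) M.T := by
    ext u
    constructor
    · rintro ⟨⟨hu, hcu⟩, htu, -⟩
      by_cases hut : u < t + h
      · rw [perturbedPremium, if_pos ⟨htu, hut⟩] at hcu
        exact absurd (hc' u ⟨hu, hcu⟩ htu) (not_le.2 hut)
      · rw [perturbedPremium, if_neg fun h' => hut h'.2] at hcu
        exact ⟨⟨hu, hcu⟩, not_lt.1 hut, hu.2⟩
    · rintro ⟨⟨hu, hcu⟩, htu, -⟩
      refine ⟨⟨hu, ?_⟩, by linarith, hu.2⟩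
      rwa [perturbedPremium, if_neg fun h' => not_le.2 h'.2 htu]
  rw [purchasingTime, purchasingTime, firstPurchase, firstPurchase, this]

lemma unitCost_kappa_le_iff {c : ℝ → ℝ} {t : ℝ} :
    M.unitCost M.kappa (t : WithTop ℝ) ≤ M.unitCost c (t : WithTop ℝ) ↔ c t ≤ M.kappa t := by
  rw [unitCost_coe, unitCost_coe, sub_le_sub_iff_left, mul_le_mul_iff_of_pos_left M.thetaR_pos,
    mul_le_mul_iff_of_pos_left (Real.exp_pos _)]

lemma unitCost_le_kappa_iff {c : ℝ → ℝ} {t : ℝ} :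
    M.unitCost c (t : WithTop ℝ) ≤ M.unitCost M.kappa (t : WithTop ℝ) ↔ M.kappa t ≤ c t := by
  rw [unitCost_coe, unitCost_coe, sub_le_sub_iff_left, mul_le_mul_iff_of_pos_left M.thetaR_pos,
    mul_le_mul_iff_of_pos_left (Real.exp_pos _)]

/-- If the rate is `κ` on the purchasing region, then purchases are made at the rate `κ`. -/
lemma unitCost_purchasingTime {c : ℝ → ℝ} (hc : M.IsPremiumStrategy c)
    (hκ : ∀ t ∈ M.purchasingRegion c, c t = M.kappa t) {t : ℝ} (ht : 0 ≤ t) :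
    M.unitCost c (M.purchasingTime c t) = M.unitCost M.kappa (M.purchasingTime c t) := by
  rcases M.purchasingTime_cases hc ht with h | ⟨τ, hτ, h⟩
  · rw [h.2, unitCost_top, unitCost_top]
  · rw [h, unitCost_coe, unitCost_coe, hκ τ hτ.1.1]

lemma unitCost_perturbedPremium_of_mem {c c' : ℝ → ℝ} {t h : ℝ} (hh : 0 < h) :
    M.unitCost (perturbedPremium c c' t h) (t : WithTop ℝ) = M.unitCost c' (t : WithTop ℝ) := by
  rw [unitCost_coe, unitCost_coe, perturbedPremium, if_pos ⟨le_rfl, by linarith⟩]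

lemma unitCost_perturbedPremium_delayed {c c' : ℝ → ℝ} (hc : M.IsPremiumStrategy c) {t h : ℝ}
    (ht : 0 ≤ t) (hh : 0 < h) :
    M.unitCost (perturbedPremium c c' t h) (M.purchasingTime c (t + h))
      = M.unitCost c (M.purchasingTime c (t + h)) := by
  rcases M.purchasingTime_cases hc (by linarith : 0 ≤ t + h) with h' | ⟨τ, hτ, h'⟩
  · rw [h'.2, unitCost_top, unitCost_top]
  · rw [h', unitCost_coe, unitCost_coe, perturbedPremium, if_neg fun h' => not_le.2 h'.2 hτ.1.2.1]

lemma unitCost_kappa_coe (p : ℝ) : M.unitCost M.kappa (p : WithTop ℝ) =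
    Real.exp (-M.bR * (M.T - p)) - M.thetaR / M.thetaI *
      Real.exp ((M.rhoR - M.bI - M.rhoI) * (M.T - p)) := by
  rw [unitCost_coe, kappa, show (M.rhoR - M.bI - M.rhoI) * (M.T - p)
    = M.rhoR * (M.T - p) + -(M.bI + M.rhoI) * (M.T - p) by ring, Real.exp_add]
  ring

end Model

/-! ### One-sided monotonicity of the unit cost at rate `κ`. -/

/-- A monotone continuous `φ` has constant sign just after `t`, and it is the sign of `G'`.
Intervals where `φ` vanishes fall under the antitone case, so strictness is available in the other
one. -/
lemma strictMonoOn_or_antitoneOn_right_of_deriv {G φ : ℝ → ℝ} {w : ℝ → ℝ} (hw : ∀ u, 0 < w u)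
    (hG : ∀ u, HasDerivAt G (w u * φ u) u) (hφ : Continuous φ) (hm : StrictMono φ ∨ Antitone φ)
    (t : ℝ) : ∃ ε > 0, StrictMonoOn G (Icc t (t + ε)) ∨ AntitoneOn G (Icc t (t + ε)) := by
  have hGc : Continuous G := continuous_iff_continuousAt.2 fun u => (hG u).continuousAt
  have hmono : ∀ ε, (∀ u ∈ Ioo t (t + ε), 0 < φ u) → StrictMonoOn G (Icc t (t + ε)) := by
    intro ε h
    refine strictMonoOn_of_deriv_pos (convex_Icc _ _) hGc.continuousOn fun u hu => ?_
    rw [interior_Icc] at hu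
    rw [(hG u).deriv]
    exact mul_pos (hw u) (h u hu)
  have hanti : ∀ ε, (∀ u ∈ Ioo t (t + ε), φ u ≤ 0) → AntitoneOn G (Icc t (t + ε)) := by
    intro ε h
    refine antitoneOn_of_deriv_nonpos (convex_Icc _ _) hGc.continuousOn
      (fun u _ => (hG u).differentiableAt.differentiableWithinAt) fun u hu => ?_
    rw [interior_Icc] at hu
    rw [(hG u).deriv]
    exact mul_nonpos_of_nonneg_of_nonpos (hw u).le (h u hu)
  have hnear : ∀ U : Set ℝ, IsOpen U → φ t ∈ U → ∃ ε > 0, ∀ u ∈ Ioo t (t + ε), φ u ∈ U := by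
    intro U hU htU
    obtain ⟨ε, hε, h⟩ := Metric.mem_nhds_iff.1 (hφ.continuousAt.preimage_mem_nhds (hU.mem_nhds htU))
    refine ⟨ε, hε, fun u hu => h ?_⟩
    rw [Metric.mem_ball, Real.dist_eq, abs_lt]
    constructor <;> linarith [hu.1, hu.2]
  rcases hm with hm | hm
  · rcases le_or_gt 0 (φ t) with h | h
    · exact ⟨1, one_pos, Or.inl (hmono 1 fun u hu => h.trans_lt (hm hu.1))⟩
    · obtain ⟨ε, hε, h'⟩ := hnear (Iio 0) isOpen_Iio h
      exact ⟨ε, hε, Or.inr (hanti ε fun u hu => le_of_lt (h' u hu))⟩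
  · rcases le_or_gt (φ t) 0 with h | h
    · exact ⟨1, one_pos, Or.inr (hanti 1 fun u hu => (hm hu.1.le).trans h)⟩
    · obtain ⟨ε, hε, h'⟩ := hnear (Ioi 0) isOpen_Ioi h
      exact ⟨ε, hε, Or.inl (hmono ε fun u hu => h' u hu)⟩

namespace Model

variable (M : Model)

/-- With the positive factor extracted, the other factor is a constant plus a multiple of a single
exponential, hence monotone. -/
lemma hasDerivAt_unitCost_kappa (p : ℝ) :
    HasDerivAt (fun p : ℝ => M.unitCost M.kappa (p : WithTop ℝ))
      (Real.exp (-M.bR * (M.T - p)) * (M.bR + M.thetaR / M.thetaI * (M.rhoR - M.bI - M.rhoI) *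
        Real.exp ((M.rhoR - M.bI - M.rhoI + M.bR) * (M.T - p)))) p := by
  simp_rw [unitCost_kappa_coe]
  have hlin : ∀ a : ℝ, HasDerivAt (fun p => a * (M.T - p)) (-a) p := fun a => by
    simpa using ((hasDerivAt_id p).const_sub M.T).const_mul a
  refine ((hlin _).exp.sub ((hlin _).exp.const_mul _)).congr_deriv ?_
  have : Real.exp ((M.rhoR - M.bI - M.rhoI) * (M.T - p)) = Real.exp (-M.bR * (M.T - p)) *
      Real.exp ((M.rhoR - M.bI - M.rhoI + M.bR) * (M.T - p)) := by
    rw [← Real.exp_add]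
    ring_nf
  rw [this]
  ring

lemma unitCost_kappa_monotone_right (t : ℝ) : ∃ ε > 0,
    StrictMonoOn (fun p : ℝ => M.unitCost M.kappa (p : WithTop ℝ)) (Icc t (t + ε)) ∨
      AntitoneOn (fun p : ℝ => M.unitCost M.kappa (p : WithTop ℝ)) (Icc t (t + ε)) := by
  refine strictMonoOn_or_antitoneOn_right_of_deriv (fun _ => Real.exp_pos _)
    M.hasDerivAt_unitCost_kappa (by fun_prop) ?_ t
  set l := M.rhoR - M.bI - M.rhoI
  have hA : 0 < M.thetaR / M.thetaI := div_pos M.thetaR_pos M.thetaI_pos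
  have hd : ∀ p, HasDerivAt (fun p => M.bR + M.thetaR / M.thetaI * l *
      Real.exp ((l + M.bR) * (M.T - p))) (M.thetaR / M.thetaI *
        Real.exp ((l + M.bR) * (M.T - p)) * -(l * (l + M.bR))) p := fun p => by
    have hlin : HasDerivAt (fun p => (l + M.bR) * (M.T - p)) (-(l + M.bR)) p := by
      simpa using ((hasDerivAt_id p).const_sub M.T).const_mul (l + M.bR)
    refine ((hlin.exp.const_mul _).const_add _).congr_deriv ?_
    ring
  rcases lt_or_ge (l * (l + M.bR)) 0 with h | h
  · refine Or.inl (strictMono_of_deriv_pos fun p => ?_)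
    rw [(hd p).deriv]
    exact mul_pos (mul_pos hA (Real.exp_pos _)) (by linarith)
  · refine Or.inr (antitone_of_deriv_nonpos (fun p => (hd p).differentiableAt) fun p => ?_)
    rw [(hd p).deriv]
    exact mul_nonpos_of_nonneg_of_nonpos (mul_pos hA (Real.exp_pos _)).le (by linarith)

end Model

/-! ### Convergence of the difference quotients. -/

/-- For `a < 0` and `0 < h < 1` one has `a / h ≤ a`, which bounds the liminf by a negative number.
-/
lemma nonneg_of_liminf_div_nonneg {f : ℝ → ℝ} {a : ℝ} (hf : ∀ᶠ h in 𝓝[>] 0, f h = a / h)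
    (h0 : 0 ≤ liminf (fun h => ((f h : ℝ) : EReal)) (𝓝[>] 0)) : 0 ≤ a := by
  by_contra ha
  push Not at ha
  have h1 : liminf (fun h => ((f h : ℝ) : EReal)) (𝓝[>] 0) ≤ (a : EReal) := by
    refine liminf_le_of_frequently_le' (Eventually.frequently ?_)
    filter_upwards [hf, Ioo_mem_nhdsGT (zero_lt_one' ℝ)] with h hh h1
    rw [hh]
    refine EReal.coe_le_coe_iff.2 ?_
    rw [div_le_iff₀ h1.1]
    nlinarith [h1.2]
  exact absurd (EReal.coe_nonneg.1 (h0.trans h1)) (not_le.2 ha)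

lemma exists_tendsto_of_eventually_eq_div {f : ℝ → ℝ} {a : ℝ} (ha : 0 ≤ a)
    (hf : ∀ᶠ h in 𝓝[>] 0, f h = a / h) :
    ∃ L : EReal, 0 ≤ L ∧ Tendsto (fun h => ((f h : ℝ) : EReal)) (𝓝[>] 0) (𝓝 L) := by
  rcases ha.eq_or_lt with rfl | ha
  · refine ⟨0, le_rfl, tendsto_const_nhds.congr' ?_⟩
    filter_upwards [hf] with h hh
    simp [hh]
  · refine ⟨⊤, le_top, EReal.tendsto_coe_nhds_top_iff.2 ?_⟩
    refine (tendsto_inv_nhdsGT_zero.const_mul_atTop ha).congr' ?_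
    filter_upwards [hf] with h hh
    rw [hh, div_eq_mul_inv]

/-- The purchases are delayed from `t` to `t + h`. If the delay cannot be profitable to first order,
and an immediate purchase is nowhere better than waiting, then the difference quotients converge. -/
lemma exists_tendsto_delay (M : Model) {c : ℝ → ℝ} (hc : M.IsPremiumStrategy c)
    (hnow : ∀ t ∈ Icc 0 M.T, M.unitCost M.kappa (M.purchasingTime c t) ≤
      M.unitCost M.kappa (t : WithTop ℝ)) {t k : ℝ} (ht : t ∈ M.purchasingRegion c) (hk : 0 ≤ k)
    {f : ℝ → ℝ} (hf : ∀ h > 0, f h = k * (M.unitCost M.kappa (M.purchasingTime c (t + h)) -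
      M.unitCost M.kappa (t : WithTop ℝ)) / h)
    (h0 : 0 ≤ liminf (fun h => ((f h : ℝ) : EReal)) (𝓝[>] 0)) :
    ∃ L : EReal, 0 ≤ L ∧ Tendsto (fun h => ((f h : ℝ) : EReal)) (𝓝[>] 0) (𝓝 L) := by
  -- If no purchase occurs just after `t`, the delayed time does not depend on small `h` and the
  -- quotient is a constant over `h`.
  by_cases hgap : ∃ δ > 0, ∀ u ∈ Ioo t (t + δ), u ∉ M.purchasingRegion c
  · obtain ⟨δ, hδ, hgap⟩ := hgap
    have hconst : ∀ᶠ h in 𝓝[>] 0, f h = k * (M.unitCost M.kappa (M.purchasingTime c (t + δ)) -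
        M.unitCost M.kappa (t : WithTop ℝ)) / h := by
      filter_upwards [Ioo_mem_nhdsGT hδ] with h hh
      rw [hf h hh.1, M.purchasingTime_congr (by linarith [hh.2] : t + h ≤ t + δ)
        fun u hu => hgap u ⟨by linarith [hu.1, hh.1], hu.2⟩]
    exact exists_tendsto_of_eventually_eq_div (nonneg_of_liminf_div_nonneg hconst h0) hconst
  push Not at hgap
  obtain ⟨ε, hε, hG⟩ := M.unitCost_kappa_monotone_right t
  obtain ⟨v, hv, hvR⟩ := hgap ε hε
  have hv0 : 0 < v - t := by linarith [hv.1]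
  have hnext : ∀ u ∈ Ioo t v, ∃ q ∈ Icc u v, M.purchasingTime c u = (q : WithTop ℝ) := by
    intro u hu
    have hvmem : v ∈ M.purchasingRegion c ∩ Icc u M.T := ⟨hvR, hu.2.le, hvR.1.2⟩
    rcases M.purchasingTime_cases hc (ht.1.1.trans hu.1.le) with h | ⟨τ, hτ, h⟩
    · simp [h.1] at hvmem
    · exact ⟨τ, ⟨hτ.1.2.1, hτ.2 hvmem⟩, h⟩
  rcases hG with hG | hG
  · have hlim : Tendsto f (𝓝[>] 0) (𝓝 (k * deriv
        (fun p : ℝ => M.unitCost M.kappa (p : WithTop ℝ)) t)) := by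
      have hd := ((M.hasDerivAt_unitCost_kappa t).differentiableAt.hasDerivAt).tendsto_slope_zero_right
      refine (hd.const_mul k).congr' ?_
      filter_upwards [Ioo_mem_nhdsGT hv0] with h hh
      have hu : t + h ∈ Ioo t v := ⟨by linarith [hh.1], by linarith [hh.2]⟩
      obtain ⟨q, hq, hpq⟩ := hnext _ hu
      have hle := hnow (t + h) ⟨ht.1.1.trans hu.1.le, hu.2.le.trans hvR.1.2⟩
      rw [hpq] at hle
      have hqu : q = t + h := by
        refine le_antisymm ((hG.le_iff_le ⟨?_, ?_⟩ ⟨?_, ?_⟩).1 hle) hq.1 <;>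
          linarith [hq.1, hq.2, hu.1, hu.2, hv.2]
      rw [hf h hh.1, hpq, hqu]
      simp only [smul_eq_mul]
      ring
    have hlim' := (continuous_coe_real_ereal.tendsto _).comp hlim
    exact ⟨_, hlim'.liminf_eq ▸ h0, hlim'⟩
  -- Nonincreasing unit cost: delay cannot raise the cost, so the quotients are at most `0`, while
  -- their liminf is at least `0`.
  · refine ⟨0, le_rfl, tendsto_of_le_liminf_of_limsup_le h0 ?_⟩
    refine limsup_le_of_le (h := ?_)
    filter_upwards [Ioo_mem_nhdsGT hv0] with h hh
    have hu : t + h ∈ Ioo t v := ⟨by linarith [hh.1], by linarith [hh.2]⟩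
    obtain ⟨q, hq, hpq⟩ := hnext _ hu
    rw [hf h hh.1, hpq]
    have hle : M.unitCost M.kappa (q : WithTop ℝ) ≤ M.unitCost M.kappa (t : WithTop ℝ) :=
      hG ⟨le_rfl, by linarith⟩ ⟨by linarith [hq.1, hu.1], by linarith [hq.2, hv.2]⟩
        (by linarith [hq.1, hu.1])
    exact EReal.coe_nonpos.2 (div_nonpos_of_nonpos_of_nonneg
      (mul_nonpos_of_nonneg_of_nonpos hk (by linarith)) hh.1.le)

/-! ### The two implications between the equilibrium notions. -/

section Equilibrium

variable {M : Model} {Ω : Type*} [MeasurableSpace Ω] {μ : Measure Ω} [IsProbabilityMeasure μ]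
  {B : ℝ≥0 → Ω → ℝ} {c : ℝ → ℝ}

/-- Perturbing by `κ` triggers a purchase at `t` for every `h`, so the quotient is a constant over
`h`. Taking `y = 0` makes the factor `ybar - y` positive. -/
lemma IsEquilibriumPremium.unitCost_le_now (hB : IsBrownianReal B μ) (hc : M.IsPremiumStrategy c)
    (hE : IsEquilibriumPremium M B μ c) {t : ℝ} (ht : t ∈ Icc 0 M.T) :
    M.unitCost c (M.purchasingTime c t) ≤ M.unitCost M.kappa (t : WithTop ℝ) := by
  obtain ⟨J, hJ⟩ := exists_cost_fullPurchaseAt_eq M hB (t := t) (y := 0) 0 ht.2 M.ybar_pos.le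
  have hκ : t ∈ M.purchasingRegion M.kappa := ⟨ht, le_rfl⟩
  have hbase : objective M B μ 0 t 0 0 c
      = J + (M.ybar - 0) * M.unitCost c (M.purchasingTime c t) :=
    hJ _ c (M.purchasingTime_admissible hc ht.1 le_rfl)
  suffices h : 0 ≤ M.ybar * (M.unitCost M.kappa (t : WithTop ℝ)
      - M.unitCost c (M.purchasingTime c t)) by
    have := nonneg_of_mul_nonneg_right h M.ybar_pos
    linarith
  rcases ht.2.eq_or_lt with rfl | htT
  · have h := hE.terminal 0 0 0 ⟨le_rfl, M.ybar_pos.le⟩ _ M.isPremiumStrategy_kappa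
    have h' : objective M B μ 0 M.T 0 0 M.kappa
        = J + (M.ybar - 0) * M.unitCost M.kappa (M.purchasingTime M.kappa M.T) :=
      hJ _ _ (M.purchasingTime_admissible M.isPremiumStrategy_kappa ht.1 le_rfl)
    rw [h', hbase, M.purchasingTime_of_mem hκ] at h
    linarith
  · refine nonneg_of_liminf_div_nonneg ?_
      (hE.interior 0 0 t ⟨ht.1, htT⟩ 0 ⟨le_rfl, M.ybar_pos.le⟩ _ M.isPremiumStrategy_kappa)
    filter_upwards [self_mem_nhdsWithin] with h hh
    have hp := M.purchasingTime_perturbedPremium_of_mem (c := c) hh hκ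
    have h' : objective M B μ 0 t 0 0 (perturbedPremium c M.kappa t h)
        = J + (M.ybar - 0) * M.unitCost (perturbedPremium c M.kappa t h)
          (M.purchasingTime (perturbedPremium c M.kappa t h) t) :=
      hJ _ _ (Or.inr ⟨t, ⟨le_rfl, ht.2⟩, hp⟩)
    rw [h', hbase, hp, M.unitCost_perturbedPremium_of_mem hh]
    ring

lemma IsEquilibriumPremium.eq_kappa (hB : IsBrownianReal B μ) (hc : M.IsPremiumStrategy c)
    (hE : IsEquilibriumPremium M B μ c) {t : ℝ} (ht : t ∈ M.purchasingRegion c) :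
    c t = M.kappa t := by
  have h := hE.unitCost_le_now hB hc ht.1
  rw [M.purchasingTime_of_mem ht] at h
  exact le_antisymm ht.2 (M.unitCost_le_kappa_iff.1 h)

lemma IsEquilibriumPremium.isEquilibriumSelectedTime (hB : IsBrownianReal B μ)
    (hc : M.IsPremiumStrategy c) (hE : IsEquilibriumPremium M B μ c) :
    IsEquilibriumSelectedTime M B μ c := by
  have hκ : ∀ t ∈ M.purchasingRegion c, c t = M.kappa t := fun t => hE.eq_kappa hB hc
  have hnow : ∀ t ∈ Icc 0 M.T, M.unitCost M.kappa (M.purchasingTime c t) ≤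
      M.unitCost M.kappa (t : WithTop ℝ) := fun t ht => by
    rw [← M.unitCost_purchasingTime hc hκ ht.1]
    exact hE.unitCost_le_now hB hc ht
  refine ⟨fun t ht y hy z => ?_, fun t ht y hy z => ?_⟩ <;>
    obtain ⟨J, hJ⟩ := exists_cost_fullPurchaseAt_eq M hB (t := t) (y := y) z ht.2 hy.2
  · rw [timeObjective, timeObjective, hJ _ _ (M.purchasingTime_admissible hc ht.1 le_rfl),
      hJ _ _ (Or.inr ⟨t, ⟨le_rfl, ht.2⟩, rfl⟩)]
    have := mul_le_mul_of_nonneg_left (hnow t ht) (sub_nonneg.2 hy.2)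
    linarith
  · have hquot : ∀ h > 0, (timeObjective M B μ t y z (M.perturbedTime c t h)
        - timeObjective M B μ t y z (M.purchasingTime c t)) / h
        = (M.ybar - y) * (M.unitCost M.kappa (M.purchasingTime c (t + h))
          - M.unitCost M.kappa (M.purchasingTime c t)) / h := by
      intro h hh
      rw [M.perturbedTime_eq c t hh, timeObjective, timeObjective,
        hJ _ _ (M.purchasingTime_admissible hc ht.1 le_rfl),
        hJ _ _ (M.purchasingTime_admissible hc ht.1 (by linarith))]
      ring
    by_cases htc : t ∈ M.purchasingRegion c
    swap
    · obtain ⟨δ, hδ, hgap⟩ := M.purchasingTime_eventually_eq hc ht.1 htc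
      refine exists_tendsto_of_eventually_eq_div le_rfl ?_
      filter_upwards [Ioo_mem_nhdsGT hδ] with h hh
      rw [hquot h hh.1, M.purchasingTime_congr (by linarith [hh.1] : t ≤ t + h)
        fun u hu huR => by linarith [hgap u huR hu.1, hu.2, hh.2]]
      simp
    have hobj : objective M B μ 0 t y z c
        = J + (M.ybar - y) * M.unitCost c (M.purchasingTime c t) :=
      hJ _ c (M.purchasingTime_admissible hc ht.1 le_rfl)
    rw [M.unitCost_purchasingTime hc hκ ht.1] at hobj
    rcases ht.2.eq_or_lt with rfl | htT
    -- At the horizon a delay means no purchase at all, which the terminal condition tests with the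
    -- rate `κ + 1`.
    · have h := hE.terminal 0 z y hy _ M.isPremiumStrategy_kappa_add_one
      have htop : M.purchasingTime (fun t => M.kappa t + 1) M.T = ⊤ :=
        M.firstPurchase_eq_top (by rw [M.purchasingRegion_kappa_add_one, empty_inter])
      have h' : objective M B μ 0 M.T y z (fun t => M.kappa t + 1)
          = J + (M.ybar - y) * M.unitCost (fun t => M.kappa t + 1)
            (M.purchasingTime (fun t => M.kappa t + 1) M.T) := hJ _ _ (Or.inl htop)
      rw [h', hobj, htop, M.unitCost_top] at h
      refine exists_tendsto_of_eventually_eq_div (a := (M.ybar - y) *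
        (0 - M.unitCost M.kappa (M.purchasingTime c M.T))) (by linarith) ?_
      filter_upwards [self_mem_nhdsWithin] with h hh
      have hh' : (0 : ℝ) < h := hh
      rw [hquot h hh, M.purchasingTime_of_gt (by linarith : M.T < M.T + h), M.unitCost_top]
    · refine exists_tendsto_delay M hc hnow htc (sub_nonneg.2 hy.2)
        (fun h hh => by rw [hquot h hh, M.purchasingTime_of_mem htc]) ?_
      refine (hE.interior 0 z t ⟨ht.1, htT⟩ y hy _ M.isPremiumStrategy_kappa_add_one).trans_eq
        (liminf_congr ?_)
      filter_upwards [self_mem_nhdsWithin] with h hh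
      have hh' : (0 : ℝ) < h := hh
      have hp := M.purchasingTime_perturbedPremium_of_forall (c := c)
        (c' := fun t => M.kappa t + 1) (t := t) hh (by simp [M.purchasingRegion_kappa_add_one])
      have h' : objective M B μ 0 t y z (perturbedPremium c (fun t => M.kappa t + 1) t h)
          = J + (M.ybar - y) * M.unitCost (perturbedPremium c (fun t => M.kappa t + 1) t h)
            (M.purchasingTime (perturbedPremium c (fun t => M.kappa t + 1) t h) t) :=
        hJ _ _ (by rw [hp]; exact M.purchasingTime_admissible hc ht.1 (by linarith))
      rw [h', hobj, hp, M.unitCost_perturbedPremium_delayed hc ht.1 hh',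
        M.unitCost_purchasingTime hc hκ (by linarith [ht.1]), hquot h hh]
      congr 1
      ring

lemma IsEquilibriumSelectedTime.isEquilibriumPremium (hB : IsBrownianReal B μ)
    (hc : M.IsPremiumStrategy c) (hκ : ∀ t ∈ M.purchasingRegion c, c t = M.kappa t)
    (hS : IsEquilibriumSelectedTime M B μ c) : IsEquilibriumPremium M B μ c := by
  have hcost : ∀ {t : ℝ} (ht : t ∈ Icc 0 M.T) {y z : ℝ} (hy : y ∈ Icc 0 M.ybar),
      ∃ J : ℝ, ∀ (p : WithTop ℝ) (c : ℝ → ℝ), (p = ⊤ ∨ ∃ q ∈ Icc t M.T, p = (q : WithTop ℝ)) →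
        cost M B μ t y z (M.fullPurchaseAt y p) c = J + (M.ybar - y) * M.unitCost c p :=
    fun ht _ _ hy => exists_cost_fullPurchaseAt_eq M hB _ ht.2 hy.2
  -- The factor `ybar - y` is kept because it may vanish.
  have hnow : ∀ t ∈ Icc 0 M.T, ∀ y ∈ Icc 0 M.ybar,
      (M.ybar - y) * M.unitCost M.kappa (M.purchasingTime c t) ≤
        (M.ybar - y) * M.unitCost M.kappa (t : WithTop ℝ) := by
    intro t ht y hy
    obtain ⟨J, hJ⟩ := hcost ht (z := 0) hy
    have h := hS.no_worse_than_now t ht y hy 0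
    rw [timeObjective, timeObjective, hJ _ _ (M.purchasingTime_admissible hc ht.1 le_rfl),
      hJ _ _ (Or.inr ⟨t, ⟨le_rfl, ht.2⟩, rfl⟩)] at h
    linarith
  refine ⟨fun x z t ht y hy c' hc' => ?_, fun x z y hy c' hc' => ?_⟩
  · have ht' : t ∈ Icc 0 M.T := ⟨ht.1, ht.2.le⟩
    obtain ⟨J, hJ⟩ := hcost ht' (z := z) hy
    have hobj : objective M B μ x t y z c
        = J + (M.ybar - y) * M.unitCost c (M.purchasingTime c t) :=
      hJ _ c (M.purchasingTime_admissible hc ht.1 le_rfl)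
    rw [M.unitCost_purchasingTime hc hκ ht.1] at hobj
    by_cases htc : t ∈ M.purchasingRegion c'
    · refine le_liminf_of_le (h := ?_)
      filter_upwards [self_mem_nhdsWithin] with h hh
      have hh' : (0 : ℝ) < h := hh
      have hp := M.purchasingTime_perturbedPremium_of_mem (c := c) hh htc
      have h' : objective M B μ x t y z (perturbedPremium c c' t h)
          = J + (M.ybar - y) * M.unitCost (perturbedPremium c c' t h)
            (M.purchasingTime (perturbedPremium c c' t h) t) :=
        hJ _ _ (Or.inr ⟨t, ⟨le_rfl, ht'.2⟩, hp⟩)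
      rw [h', hobj, hp, M.unitCost_perturbedPremium_of_mem hh]
      refine EReal.coe_nonneg.2 (div_nonneg ?_ hh'.le)
      have h1 := mul_le_mul_of_nonneg_left (M.unitCost_kappa_le_iff.2 htc.2) (sub_nonneg.2 hy.2)
      linarith [hnow t ht' y hy]
    -- For `h < δ` the rate `c'` triggers nothing on `[t, t + h)`, so the quotient is the one for
    -- delay, and its limit is its liminf.
    · obtain ⟨δ, hδ, hgap⟩ := M.purchasingTime_eventually_eq hc' ht.1 htc
      obtain ⟨L, hL, hlim⟩ := hS.no_worse_than_delay t ht' y hy z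
      refine (hlim.congr' ?_).liminf_eq.symm ▸ hL
      filter_upwards [Ioo_mem_nhdsGT hδ] with h hh
      have hp := M.purchasingTime_perturbedPremium_of_forall (c := c) hh.1
        fun u hu htu => (by linarith [hgap u hu htu, hh.2] : t + h ≤ u)
      have hadm := M.purchasingTime_admissible hc ht.1 (by linarith [hh.1] : t ≤ t + h)
      have h' : objective M B μ x t y z (perturbedPremium c c' t h)
          = J + (M.ybar - y) * M.unitCost (perturbedPremium c c' t h)
            (M.purchasingTime (perturbedPremium c c' t h) t) :=
        hJ _ _ (by rwa [hp])
      rw [h', hobj, hp, M.unitCost_perturbedPremium_delayed hc ht.1 hh.1,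
        M.unitCost_purchasingTime hc hκ (by linarith [ht.1, hh.1]),
        M.perturbedTime_eq c t hh.1, timeObjective, timeObjective, hJ _ _ hadm,
        hJ _ _ (M.purchasingTime_admissible hc ht.1 le_rfl)]
  · have hT : M.T ∈ Icc 0 M.T := ⟨M.T_pos.le, le_rfl⟩
    obtain ⟨J, hJ⟩ := hcost hT (z := z) hy
    have hobj : ∀ {c}, M.IsPremiumStrategy c → objective M B μ x M.T y z c
        = J + (M.ybar - y) * M.unitCost c (M.purchasingTime c M.T) :=
      fun hc => hJ _ _ (M.purchasingTime_admissible hc hT.1 le_rfl)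
    rw [hobj hc', hobj hc, M.unitCost_purchasingTime hc hκ hT.1]
    by_cases hTc' : M.T ∈ M.purchasingRegion c'
    · rw [M.purchasingTime_of_mem hTc']
      have h1 := mul_le_mul_of_nonneg_left (M.unitCost_kappa_le_iff.2 hTc'.2) (sub_nonneg.2 hy.2)
      linarith [hnow _ hT y hy]
    have htop : ∀ {c}, M.T ∉ M.purchasingRegion c → M.purchasingTime c M.T = ⊤ := fun h =>
      M.firstPurchase_eq_top (by rw [Icc_self, inter_singleton_eq_empty]; exact h)
    rw [htop hTc', M.unitCost_top]
    by_cases hTc : M.T ∈ M.purchasingRegion c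
    -- Delay at the horizon means no purchase for every `h > 0`, so the delay condition reduces to
    -- the sign of a constant.
    · obtain ⟨L, hL, hlim⟩ := hS.no_worse_than_delay _ hT y hy z
      have h := nonneg_of_liminf_div_nonneg (a := (M.ybar - y) *
        (0 - M.unitCost M.kappa (M.purchasingTime c M.T))) ?_ (hlim.liminf_eq.symm ▸ hL)
      · linarith
      filter_upwards [self_mem_nhdsWithin] with h hh
      have hh' : (0 : ℝ) < h := hh
      rw [M.perturbedTime_eq c _ hh', M.purchasingTime_of_gt (by linarith : M.T < M.T + h),
        timeObjective, timeObjective, hJ _ _ (Or.inl rfl),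
        hJ _ _ (M.purchasingTime_admissible hc hT.1 le_rfl), M.unitCost_top]
      congr 1
      ring
    · rw [htop hTc, M.unitCost_top]
      simp

end Equilibrium

end Reinsurance

end

theorem corollary4p1 (M : Reinsurance.Model) {Ω : Type*} [MeasurableSpace Ω]
    (μ : Measure Ω) [IsProbabilityMeasure μ]
    (B : ℝ≥0 → Ω → ℝ) (hB : IsBrownianReal B μ)
    (c : ℝ → ℝ) (hc : M.IsPremiumStrategy c) :
    Reinsurance.IsEquilibriumPremium M B μ c ↔
      (∀ t ∈ M.purchasingRegion c, c t = M.kappa t) ∧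
        Reinsurance.IsEquilibriumSelectedTime M B μ c := by
  refine ⟨fun hE => ⟨fun t ht => hE.eq_kappa hB hc ht, hE.isEquilibriumSelectedTime hB hc⟩, ?_⟩
  rintro ⟨hκ, hS⟩
  exact hS.isEquilibriumPremium hB hc hκ
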